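/- Let $\Sigma$ be a (possibly infinite) alphabet. A pomset over $\Sigma$ is an isomorphism class of $\Sigma$-labelled posets; $1$ is the empty pomset, $a\in\Sigma$ also denotes the one-event pomset labelled $a$, $U\parallel V$ is the disjoint union of $U$ and $V$ without order between them, and $U\cdot V$ is the disjoint union in which moreover every event of $U$ is below every event of $V$. The series-parallel pomsets are those generated from $1$ and the $a\in\Sigma$ by $\cdot$ and $\parallel$; a step is a pomset in which distinct events are unordered, and $\mathsf{S}(\Sigma)$ is the set of series-parallel steps. The spr-expressions are $x,y::=0\mid 1\mid a\in\Sigma\mid x+y\mid x\cdot y\mid x^*\mid x\parallel y\mid x^{\langle *\rangle}$, with semantics the sets of pomsets $[\![0]\!]=\emptyset$, $[\![1]\!]=\{1\}$, $[\![a]\!]=\{a\}$, $[\![x+y]\!]=[\![x]\!]\cup[\![y]\!]$, $[\![x\cdot y]\!]=[\![x]\!]\cdot[\![y]\!]$, $[\![x\parallel y]\!]=[\![x]\!]\parallel[\![y]\!]$ (elementwise compositions), $[\![x^*]\!]=\bigcup_{n\ge 0}[\![x]\!]^n$ and $[\![x^{\langle *\rangle}]\!]=\bigcup_{n\ge 0}[\![x]\!]^{\langle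 n\rangle}$, the unions of all sequential, respectively parallel, powers, the $0$-th power being $\{1\}$. A step automaton is a tuple $A=(Q,F,\delta,\gamma)$ with a set $Q$ of states, a set $F\subseteq Q$ of accepting states, and transition functions $\delta:(Q\setminus F)\times\Sigma\to 2^Q$ and $\gamma:(Q\setminus F)\times\mathsf{S}(\Sigma)\to 2^Q$. It is finite if $Q$ is finite and there are finitely many transitions, that is, finitely many triples $(q,a,q')$ with $q'\in\delta(q,a)$ and finitely many triples $(q,U,q')$ with $q'\in\gamma(q,U)$. The unit runs of $A$ are $q\xrightarrow{1}q$ for $q\in Q$, $q\xrightarrow{a}q'$ for $q'\in\delta(q,a)$, and $q\xrightarrow{U}q'$ for $q'\in\gamma(q,U)$. A path is a finite sequence of consecutive unit runs; its label is the sequential composition of their labels ($1$ for the empty path). The language $L_A(q)$ is the set of labels of paths from $q$ to a state in $F$. Let $\preceq$ be the smallest preorder on $Q$ with $q'\preceq q$ whenever $q'\in\delta(q,a)$ or $q'\in\gamma(q,U)$ for some $a$ or $U$, and write $q'\prec q$ if $q'\preceq q$ and $q\not\preceq q'$. The automaton $A$ is well-nested if $q'\prec q$ whenever $q'\in\delta(q,a)$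 or $q'\in\gamma(q,U)$ for some $a$ or $U$. **Theorem.** Let $A$ be a finite, well-nested step automaton over $\Sigma$. Then for every state $q$ of $A$ there is an spr-expression $x$ with $L_A(q)=[\![x]\!]$. -/

import Mathlib

namespace StepAut

universe u v

/-! ### Labelled posets and pomsets -/

/-- A labelled poset over the alphabet `α`. -/
structure LPoset (α : Type u) : Type (max u 1) where
  carrier : Type
  order : PartialOrder carrier
  label : carrier → α

attribute [instance] LPoset.order

namespace LPoset

variable {α : Type u}

/-- Isomorphism of labelled posets: a label-preserving order isomorphism. -/
def Iso (x y : LPoset α) : Prop :=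
  ∃ e : x.carrier ≃o y.carrier, ∀ s, y.label (e s) = x.label s

/-- The empty labelled poset. -/
def empty (α : Type u) : LPoset α where
  carrier := Empty
  order := inferInstance
  label := Empty.elim

/-- The labelled poset with exactly one event, labelled `a`. -/
def single (a : α) : LPoset α where
  carrier := Unit
  order := inferInstance
  label := fun _ => a

/-- Parallel composition: the disjoint union, with no order between the two parts. -/
def par (x y : LPoset α) : LPoset α where
  carrier := x.carrier ⊕ y.carrier
  order := inferInstance
  label := Sum.elim x.label y.label

/-- Sequential composition: the disjoint union, where moreover every event of the first part
lies below every event of the second part. -/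
def seq (x y : LPoset α) : LPoset α where
  carrier := x.carrier ⊕ₗ y.carrier
  order := inferInstance
  label := fun s => Sum.elim x.label y.label (ofLex s)

/-- No two distinct events are ordered. -/
def Discrete (x : LPoset α) : Prop :=
  ∀ s t : x.carrier, s ≤ t → s = t

theorem Iso.refl (x : LPoset α) : Iso x x := ⟨OrderIso.refl _, fun _ => rfl⟩

theorem Iso.symm {x y : LPoset α} : Iso x y → Iso y x := by
  rintro ⟨e, h⟩
  exact ⟨e.symm, fun s => by rw [← h, e.apply_symm_apply]⟩

theorem Iso.trans {x y z : LPoset α} : Iso x y → Iso y z → Iso x z := by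
  rintro ⟨e, h⟩ ⟨f, k⟩
  exact ⟨e.trans f, fun s => by rw [OrderIso.trans_apply, k, h]⟩

theorem Iso.par {x x' y y' : LPoset α} :
    Iso x x' → Iso y y' → Iso (x.par y) (x'.par y') := by
  rintro ⟨e, h⟩ ⟨f, k⟩
  refine ⟨OrderIso.sumCongr e f, ?_⟩
  rintro (s | s)
  · exact h s
  · exact k s

theorem Iso.seq {x x' y y' : LPoset α} :
    Iso x x' → Iso y y' → Iso (x.seq y) (x'.seq y') := by
  rintro ⟨e, h⟩ ⟨f, k⟩
  refine ⟨OrderIso.sumLexCongr e f, ?_⟩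
  rintro (s | s)
  · exact h s
  · exact k s

instance setoid (α : Type u) : Setoid (LPoset α) where
  r := Iso
  iseqv := ⟨Iso.refl, Iso.symm, Iso.trans⟩

end LPoset

/-- Pomsets: labelled posets up to isomorphism. -/
def Pomset (α : Type u) : Type (max u 1) := Quotient (LPoset.setoid α)

namespace Pomset

variable {α : Type u}

/-- The pomset represented by a labelled poset. -/
def mk (x : LPoset α) : Pomset α := Quotient.mk _ x

/-- The empty pomset, usually written `1`. -/
def one : Pomset α := mk (LPoset.empty α)

/-- The primitive pomset with the single action `a`. -/
def prim (a : α) : Pomset α := mk (LPoset.single a)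

/-- Sequential composition of pomsets. -/
def seq : Pomset α → Pomset α → Pomset α :=
  Quotient.map₂ LPoset.seq fun _ _ h _ _ k => LPoset.Iso.seq h k

/-- Parallel composition of pomsets. -/
def par : Pomset α → Pomset α → Pomset α :=
  Quotient.map₂ LPoset.par fun _ _ h _ _ k => LPoset.Iso.par h k

/-- A pomset is a step if it has no order between distinct events. -/
def IsStep (U : Pomset α) : Prop := ∃ x : LPoset α, mk x = U ∧ x.Discrete

/-- Series-parallel pomsets. -/
inductive IsSP : Pomset α → Prop
  | one : IsSP one
  | prim (a : α) : IsSP (prim a)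
  | seq {U V : Pomset α} : IsSP U → IsSP V → IsSP (seq U V)
  | par {U V : Pomset α} : IsSP U → IsSP V → IsSP (par U V)

end Pomset

/-- Series-parallel steps over `α` (equivalently, finite multisets of actions). -/
def SPStep (α : Type u) : Type (max u 1) := {U : Pomset α // U.IsSP ∧ U.IsStep}

/-! ### Pomset languages and series-parallel rational expressions -/

namespace PomLang

variable {α : Type u}

/-- Sequential composition of pomset languages. -/
def seq (L K : Set (Pomset α)) : Set (Pomset α) :=
  {W | ∃ U ∈ L, ∃ V ∈ K, W = Pomset.seq U V}

/-- Parallel composition of pomset languages. -/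
def par (L K : Set (Pomset α)) : Set (Pomset α) :=
  {W | ∃ U ∈ L, ∃ V ∈ K, W = Pomset.par U V}

/-- Sequential powers. -/
def seqPow (L : Set (Pomset α)) : ℕ → Set (Pomset α)
  | 0 => {Pomset.one}
  | n + 1 => seq (seqPow L n) L

/-- Parallel powers. -/
def parPow (L : Set (Pomset α)) : ℕ → Set (Pomset α)
  | 0 => {Pomset.one}
  | n + 1 => par (parPow L n) L

/-- Kleene star. -/
def star (L : Set (Pomset α)) : Set (Pomset α) := ⋃ n : ℕ, seqPow L n

/-- Parallel star. -/
def parStar (L : Set (Pomset α)) : Set (Pomset α) := ⋃ n : ℕ, parPow L n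

end PomLang

/-- Series-parallel rational expressions over the alphabet `α`. -/
inductive SPRExpr (α : Type u) : Type u
  | zero : SPRExpr α
  | one : SPRExpr α
  | atom (a : α) : SPRExpr α
  | add (x y : SPRExpr α) : SPRExpr α
  | seq (x y : SPRExpr α) : SPRExpr α
  | star (x : SPRExpr α) : SPRExpr α
  | par (x y : SPRExpr α) : SPRExpr α
  | parStar (x : SPRExpr α) : SPRExpr α

/-- The language semantics of series-parallel rational expressions. -/
def SPRExpr.sem {α : Type u} : SPRExpr α → Set (Pomset α)
  | .zero => ∅
  | .one => {Pomset.one}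
  | .atom a => {Pomset.prim a}
  | .add x y => x.sem ∪ y.sem
  | .seq x y => PomLang.seq x.sem y.sem
  | .star x => PomLang.star x.sem
  | .par x y => PomLang.par x.sem y.sem
  | .parStar x => PomLang.parStar x.sem

/-! ### Step automata -/

/-- A step automaton over the alphabet `α` with state set `Q`. Finiteness is imposed separately,
by `StepAutomaton.IsFinite`. -/
structure StepAutomaton (α : Type u) (Q : Type v) where
  /-- The accepting states. -/
  F : Set Q
  /-- The sequential transition function, defined on `Q \ F`. -/
  δ : {q : Q // q ∉ F} → α → Set Q
  /-- The step transition function, defined on `Q \ F`. -/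
  γ : {q : Q // q ∉ F} → SPStep α → Set Q

namespace StepAutomaton

variable {α : Type u} {Q : Type v} (A : StepAutomaton α Q)

/-- There are finitely many states and finitely many transitions. -/
def IsFinite : Prop :=
  Finite Q ∧
  {t : {q : Q // q ∉ A.F} × α × Q | t.2.2 ∈ A.δ t.1 t.2.1}.Finite ∧
  {t : {q : Q // q ∉ A.F} × SPStep α × Q | t.2.2 ∈ A.γ t.1 t.2.1}.Finite

/-- The run relation: `A.Run q U q'` says that there is a unit run from `q` to `q'` with
label `U`. -/
inductive Run : Q → Pomset α → Q → Prop
  | idle (q : Q) : Run q Pomset.one q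
  | act (q : {q : Q // q ∉ A.F}) (a : α) (q' : Q) (h : q' ∈ A.δ q a) : Run q (Pomset.prim a) q'
  | step (q : {q : Q // q ∉ A.F}) (U : SPStep α) (q' : Q) (h : q' ∈ A.γ q U) : Run q U.1 q'

/-- Paths. The label of a path is the sequential composition of the labels of its unit runs. -/
inductive Path : Q → Pomset α → Q → Prop
  | nil (q : Q) : Path q Pomset.one q
  | cons {p q r : Q} {U w : Pomset α} (h : A.Run p U q) (hw : Path q w r) :
      Path p (Pomset.seq U w) r

/-- The language accepted by the state `q`. -/
def language (q : Q) : Set (Pomset α) := {w | ∃ q' ∈ A.F, A.Path q w q'}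

/-- `A.Supports q' q` is the support relation `q' ⪯ q`: the smallest preorder such that the
target of every transition is below its source. -/
inductive Supports : Q → Q → Prop
  | refl (q : Q) : Supports q q
  | trans {p q r : Q} : Supports p q → Supports q r → Supports p r
  | act (q : {q : Q // q ∉ A.F}) (a : α) (q' : Q) (h : q' ∈ A.δ q a) : Supports q' q
  | step (q : {q : Q // q ∉ A.F}) (U : SPStep α) (q' : Q) (h : q' ∈ A.γ q U) : Supports q' q

/-- The strict support relation `q' ≺ q`. -/
def StrictSupports (q' q : Q) : Prop := A.Supports q' q ∧ ¬ A.Supports q q'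

/-- A state is recursive if all its transitions lead to strictly smaller states. (A state in `F`
has no outgoing transitions.) -/
def Recursive (q : Q) : Prop :=
  ∀ hq : q ∉ A.F,
    (∀ (a : α) (q' : Q), q' ∈ A.δ ⟨q, hq⟩ a → A.StrictSupports q' q) ∧
    (∀ (U : SPStep α) (q' : Q), q' ∈ A.γ ⟨q, hq⟩ U → A.StrictSupports q' q)

/-- A step automaton is well-nested if every state is recursive. -/
def WellNested : Prop := ∀ q : Q, A.Recursive q

end StepAutomaton

end StepAut

namespace StepAut

universe u v

/-! Well-nestedness makes every transition strictly descend in `≺`, so apart from idling a path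
never returns to a state it has left. A path from a non-accepting state to an accepting one must,
after idling, take a transition; hence `L(q)` is the union of the languages `{U} · L(q')` over the
finitely many transitions from `q` (`language_of_notMem`), while accepting states have language
`{1}`. As `Q` is finite, `≺` is well-founded, and induction along it gives an expression for each
state. The expressions built this way use neither star. -/

/-- The languages denoted by series-parallel rational expressions. -/
def IsRational {α : Type u} (L : Set (Pomset α)) : Prop := ∃ x : SPRExpr α, L = x.sem

/-- This lets idling unit runs be deleted from a path without changing its label. -/
theorem Pomset.one_seq {α : Type u} (U : Pomset α) : Pomset.seq Pomset.one U = U := by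
  induction U using Quotient.inductionOn with
  | _ x =>
    refine Quotient.sound ⟨
      { toFun := fun s => Sum.elim Empty.elim id (ofLex s)
        invFun := fun s => toLex (Sum.inr s)
        left_inv := ?_
        right_inv := fun _ => rfl
        map_rel_iff' := ?_ }, ?_⟩
    · rintro (s | s)
      · exact s.elim
      · rfl
    · rintro (s | s) (t | t)
      · exact s.elim
      · exact s.elim
      · exact t.elim
      · exact Sum.Lex.inr_le_inr_iff.symm
    · rintro (s | s)
      · exact s.elim
      · rfl

namespace IsRational

variable {α : Type u}

theorem empty : IsRational (∅ : Set (Pomset α)) := ⟨.zero, rfl⟩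

theorem union {L K : Set (Pomset α)} : IsRational L → IsRational K → IsRational (L ∪ K) := by
  rintro ⟨x, rfl⟩ ⟨y, rfl⟩
  exact ⟨.add x y, rfl⟩

theorem seq {L K : Set (Pomset α)} :
    IsRational L → IsRational K → IsRational (PomLang.seq L K) := by
  rintro ⟨x, rfl⟩ ⟨y, rfl⟩
  exact ⟨.seq x y, rfl⟩

theorem par {L K : Set (Pomset α)} :
    IsRational L → IsRational K → IsRational (PomLang.par L K) := by
  rintro ⟨x, rfl⟩ ⟨y, rfl⟩
  exact ⟨.par x y, rfl⟩

theorem biUnion {ι : Type*} {S : Set ι} (hS : S.Finite) {L : ι → Set (Pomset α)}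
    (hL : ∀ i ∈ S, IsRational (L i)) : IsRational (⋃ i ∈ S, L i) := by
  induction S, hS using Set.Finite.induction_on with
  | empty => simpa using empty
  | insert _ _ ih =>
    rw [Set.biUnion_insert]
    exact (hL _ (Set.mem_insert _ _)).union
      (ih fun i hi => hL i (Set.mem_insert_of_mem _ hi))

/-- Composing two singletons gives a singleton, so a series-parallel term is itself an expression.
This is where step labels have to be series-parallel. -/
theorem singleton {U : Pomset α} (hU : U.IsSP) : IsRational {U} := by
  induction hU with
  | one => exact ⟨.one, rfl⟩
  | prim a => exact ⟨.atom a, rfl⟩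
  | seq _ _ hU hV => simpa [PomLang.seq, Set.ofPred_eq_eq_singleton] using hU.seq hV
  | par _ _ hU hV => simpa [PomLang.par, Set.ofPred_eq_eq_singleton] using hU.par hV

end IsRational

namespace StepAutomaton

variable {α : Type u} {Q : Type v} {A : StepAutomaton α Q}

/-- A path is either trivial, or it starts with a transition up to idling. -/
theorem Path.trivial_or_transition {p r : Q} {w : Pomset α} (h : A.Path p w r) :
    (p = r ∧ w = Pomset.one) ∨
    (∃ (hp : p ∉ A.F) (a : α) (q : Q), q ∈ A.δ ⟨p, hp⟩ a ∧
      ∃ w', A.Path q w' r ∧ w = Pomset.seq (Pomset.prim a) w') ∨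
    (∃ (hp : p ∉ A.F) (U : SPStep α) (q : Q), q ∈ A.γ ⟨p, hp⟩ U ∧
      ∃ w', A.Path q w' r ∧ w = Pomset.seq U.1 w') := by
  induction h with
  | nil q => exact .inl ⟨rfl, rfl⟩
  | cons h hw ih =>
    cases h with
    -- The label is that of the remaining path, which starts at the same state, so the induction
    -- hypothesis is the goal.
    | idle => rwa [Pomset.one_seq]
    | act p a q h => exact .inr (.inl ⟨p.2, a, _, h, _, hw, rfl⟩)
    | step p U q h => exact .inr (.inr ⟨p.2, U, _, h, _, hw, rfl⟩)

theorem language_of_mem {q : Q} (hq : q ∈ A.F) : A.language q = {Pomset.one} := by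
  ext w
  constructor
  · rintro ⟨r, -, h⟩
    obtain ⟨-, h⟩ | ⟨hp, -⟩ | ⟨hp, -⟩ := h.trivial_or_transition
    · exact h
    · exact absurd hq hp
    · exact absurd hq hp
  · rintro rfl
    exact ⟨q, hq, .nil q⟩

/-- The unions range over whole transition triples, cut down to those with source `q`. Their index
sets are thus subsets of the sets that `IsFinite` declares finite, even when `α` is infinite. -/
theorem language_of_notMem {q : Q} (hq : q ∉ A.F) :
    A.language q =
      (⋃ t ∈ {t : {q : Q // q ∉ A.F} × α × Q | t.2.2 ∈ A.δ t.1 t.2.1} ∩ {t | t.1 = ⟨q, hq⟩},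
        PomLang.seq {Pomset.prim t.2.1} (A.language t.2.2)) ∪
      ⋃ t ∈ {t : {q : Q // q ∉ A.F} × SPStep α × Q | t.2.2 ∈ A.γ t.1 t.2.1} ∩
          {t | t.1 = ⟨q, hq⟩},
        PomLang.seq {t.2.1.1} (A.language t.2.2) := by
  ext w
  simp only [Set.mem_union, Set.mem_iUnion]
  constructor
  · rintro ⟨r, hr, h⟩
    obtain ⟨rfl, -⟩ | ⟨_, a, q', hd, w', hw', rfl⟩ | ⟨_, U, q', hd, w', hw', rfl⟩ :=
      h.trivial_or_transition
    -- A trivial path would end at `q`, which is not accepting.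
    · exact absurd hr hq
    · exact .inl ⟨(⟨q, hq⟩, a, q'), ⟨hd, rfl⟩, _, rfl, w', ⟨r, hr, hw'⟩, rfl⟩
    · exact .inr ⟨(⟨q, hq⟩, U, q'), ⟨hd, rfl⟩, _, rfl, w', ⟨r, hr, hw'⟩, rfl⟩
  · rintro (⟨⟨p, a, q'⟩, ⟨h, rfl⟩, _, rfl, w', ⟨r, hr, hw'⟩, rfl⟩ |
      ⟨⟨p, U, q'⟩, ⟨h, rfl⟩, _, rfl, w', ⟨r, hr, hw'⟩, rfl⟩)
    · exact ⟨r, hr, .cons (.act _ a q' h) hw'⟩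
    · exact ⟨r, hr, .cons (.step _ U q' h) hw'⟩

/-- The strict part of a preorder is transitive and irreflexive, hence well-founded on a finite set.
-/
theorem wellFounded_strictSupports [Finite Q] : WellFounded A.StrictSupports :=
  haveI : IsTrans Q A.StrictSupports :=
    ⟨fun _ _ _ h k => ⟨h.1.trans k.1, fun l => h.2 (k.1.trans l)⟩⟩
  haveI : Std.Irrefl A.StrictSupports := ⟨fun _ h => h.2 h.1⟩
  Finite.wellFounded_of_trans_of_irrefl _

theorem isRational_language (hfin : A.IsFinite) (hwn : A.WellNested) (q : Q) :
    IsRational (A.language q) := by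
  obtain ⟨_, hδ, hγ⟩ := hfin
  induction q using (wellFounded_strictSupports (A := A)).induction with
  | _ q ih =>
    by_cases hq : q ∈ A.F
    · rw [language_of_mem hq]
      exact .singleton .one
    · rw [language_of_notMem hq]
      refine .union (.biUnion (hδ.inter_of_left _) ?_) (.biUnion (hγ.inter_of_left _) ?_)
      · rintro ⟨_, a, q'⟩ ⟨h, rfl⟩
        -- `hwn` puts the target strictly below the source, so the induction hypothesis applies to
        -- it.
        exact .seq (.singleton (.prim a)) (ih q' ((hwn q hq).1 a q' h))
      · rintro ⟨_, U, q'⟩ ⟨h, rfl⟩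
        exact .seq (.singleton U.2.1) (ih q' ((hwn q hq).2 U q' h))

end StepAutomaton

end StepAut

theorem mainTheorem3 {α : Type*} {Q : Type*} (A : StepAut.StepAutomaton α Q)
    (hfin : A.IsFinite) (hwn : A.WellNested) (q : Q) :
    ∃ x : StepAut.SPRExpr α, A.language q = x.sem :=
  StepAut.StepAutomaton.isRational_language hfin hwn q
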